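/- Let $q$ be a power of a prime, $A=\mathbb F_q[\theta]$, $K=\mathbb F_q(\theta)$ with the absolute value determined by $|a|=q^{\deg a}$ for $0\ne a\in A$, $K_\infty$ the completion of $K$, $\mathbb C_\infty$ the completion of an algebraic closure of $K_\infty$, $\Omega=\mathbb C_\infty\setminus K_\infty$, and $A_+\subset A$ the set of monic polynomials. For a lattice $\Lambda\subset\mathbb C_\infty$ put $e_\Lambda(\zeta)=\zeta\prod_{0\ne\lambda\in\Lambda}(1-\zeta/\lambda)$. Fix $\tilde\pi\in\mathbb C_\infty$ such that $\tilde\pi A$ is the lattice of the Carlitz module, i.e. $e_{\tilde\pi A}(\theta\zeta)=\theta e_{\tilde\pi A}(\zeta)+e_{\tilde\pi A}(\zeta)^q$ for all $\zeta\in\mathbb C_\infty$. For $z\in\Omega$ let $\Lambda_z=zA\oplus A$ and $$s_{Car}(t)=\sum_{n\ge0}e_{\tilde\pi A}\Big(\frac{\tilde\pi}{\theta^{n+1}}\Big)t^n,\quad s_1(z,t)=\sum_{n\ge0}e_{\Lambda_z}\Big(\frac{z}{\theta^{n+1}}\Big)t^n,\quad s_2(z,t)=\sum_{n\ge0}e_{\Lambda_z}\Big(\frac{1}{\theta^{n+1}}\Big)t^n,$$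 and let $d_i(z,t)=\tilde\pi\, s_{Car}(t)^{-1}s_i(z,t)$ for $i=1,2$; these are power series in $t$ that converge for all $t\in\mathbb C_\infty$. For $a\in A$ write $\chi_t(a)=a(t)$, and for positive integers $\alpha,\beta$ put $L(\chi_t^\alpha,\beta)=\sum_{a\in A_+}\chi_t(a)^\alpha a^{-\beta}$. For integers $l\ge1$ and $k\ge0$ define $$\mathcal G_{l,k}(z,t)=\frac1{L(\chi_t^l,lq^k)}\sum_{(c,d)\in A^2\setminus\{(0,0)\}}\left(\frac{\chi_t(c)\,d_1(z,t)+\chi_t(d)\,d_2(z,t)}{(cz+d)^{q^k}}\right)^l .$$ Let $1\le l\le q$ and $k\ge0$. Then for all $z\in\Omega$ and all $t\in\mathbb C_\infty$ with $|t|<q^{q^k}$, the series $L(\chi_t^l,lq^k)$ converges to a nonzero value, the series over $(c,d)$ defining $\mathcal G_{l,k}(z,t)$ converges, and $$\mathcal G_{l,k}(z,t)=(-1)^{l+1}\,\mathcal G_{1,k}(z,t)^l .$$ -/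

import Mathlib

open Polynomial

namespace PellarinEisenstein

noncomputable section

/-! ### The fields `K ⊂ K_∞ ⊂ ℂ_∞` attached to `A = 𝔽_q[θ]`

`F` is a finite field with `q` elements, `A = F[X]` with `θ = X`, and `K = RatFunc F`. -/

section Fields

variable (F : Type*) [Field F] [Fintype F]

lemma one_lt_q : (1 : ℝ) < Fintype.card F := by
  exact_mod_cast Fintype.one_lt_card

open scoped Classical in
lemma infty_add_le_max (x y : RatFunc F) :
    (if x + y = 0 then (0 : ℝ) else (Fintype.card F : ℝ) ^ (x + y).intDegree) ≤
      max (if x = 0 then (0 : ℝ) else (Fintype.card F : ℝ) ^ x.intDegree)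
        (if y = 0 then (0 : ℝ) else (Fintype.card F : ℝ) ^ y.intDegree) := by
  have hq := one_lt_q F
  have hpos : ∀ n : ℤ, (0 : ℝ) < (Fintype.card F : ℝ) ^ n := fun n => by positivity
  by_cases hx : x = 0
  · simp [hx]
  by_cases hy : y = 0
  · simp [hy]
  by_cases hxy : x + y = 0
  · simp [hxy, hx, hy, (hpos _).le]
  · simp only [hx, hy, hxy, if_false, le_max_iff]
    rcases le_max_iff.1 (RatFunc.intDegree_add_le hy hxy) with h | h
    · exact Or.inl (zpow_le_zpow_right₀ hq.le h)
    · exact Or.inr (zpow_le_zpow_right₀ hq.le h)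

open scoped Classical in
/-- The absolute value of `K` with `|a| = q ^ deg a` for `a ∈ A` nonzero. -/
def inftyAbs : AbsoluteValue (RatFunc F) ℝ where
  toFun f := if f = 0 then 0 else (Fintype.card F : ℝ) ^ f.intDegree
  map_mul' x y := by
    have hq := one_lt_q F
    by_cases hx : x = 0
    · simp [hx]
    by_cases hy : y = 0
    · simp [hy]
    simp only [hx, hy, mul_eq_zero, or_self, if_false, RatFunc.intDegree_mul hx hy]
    exact zpow_add₀ (by positivity) _ _
  nonneg' x := by
    split_ifs
    · exact le_rfl
    · positivity
  eq_zero' x := by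
    have hq := one_lt_q F
    by_cases hx : x = 0
    · simp [hx]
    · have : (Fintype.card F : ℝ) ^ x.intDegree ≠ 0 := by positivity
      simp [hx, this]
  add_le' x y := by
    refine (infty_add_le_max F x y).trans (max_le_add_of_nonneg ?_ ?_) <;>
    · split_ifs
      · exact le_rfl
      · positivity

/-- `K_∞`, the completion of `K` with respect to `|·|`. -/
abbrev Kinf : Type _ := (inftyAbs F).Completion

/-- The embedding `K → K_∞`. -/
def toKinf : RatFunc F →+* Kinf F :=
  UniformSpace.Completion.coeRingHom.comp (WithAbs.equiv (inftyAbs F)).symm.toRingHom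

lemma norm_toKinf (f : RatFunc F) : ‖toKinf F f‖ = inftyAbs F f :=
  UniformSpace.Completion.norm_coe _

instance : IsUltrametricDist (Kinf F) :=
  IsUltrametricDist.isUltrametricDist_of_forall_norm_add_le_max_norm fun x y => by
    refine UniformSpace.Completion.induction_on₂ x y
      (isClosed_le (by fun_prop) (by fun_prop)) fun a b => ?_
    rw [← UniformSpace.Completion.coe_add]
    simp only [UniformSpace.Completion.norm_coe]
    exact infty_add_le_max F a.ofAbs b.ofAbs

instance : NontriviallyNormedField (Kinf F) where
  non_trivial := ⟨toKinf F RatFunc.X, by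
    rw [norm_toKinf]
    simpa [inftyAbs, RatFunc.X_ne_zero] using one_lt_q F⟩

/-- A fixed algebraic closure of `K_∞`. -/
abbrev KinfAlgCl : Type _ := AlgebraicClosure (Kinf F)

/-- The algebraic closure of `K_∞` carries the unique extension of `|·|`. -/
instance : NormedField (KinfAlgCl F) := spectralNorm.normedField (Kinf F) (KinfAlgCl F)

instance : NormedAlgebra (Kinf F) (KinfAlgCl F) := spectralNorm.normedAlgebra _ _

instance : UniformContinuousConstSMul (Kinf F) (KinfAlgCl F) :=
  uniformContinuousConstSMul_of_continuousConstSMul (Kinf F) (KinfAlgCl F)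

/-- `ℂ_∞`, the completion of the algebraic closure of `K_∞`. -/
abbrev Cinf : Type _ := UniformSpace.Completion (KinfAlgCl F)

/-- The Drinfeld upper half-plane `Ω = ℂ_∞ ∖ K_∞`. -/
def Omega : Set (Cinf F) := (Set.range (algebraMap (Kinf F) (Cinf F)))ᶜ

/-- The embedding `A → ℂ_∞`. -/
def toC : F[X] →+* Cinf F :=
  ((algebraMap (Kinf F) (Cinf F)).comp (toKinf F)).comp (algebraMap F[X] (RatFunc F))

end Fields

section Objects

variable {F : Type*} [Field F] [Fintype F]

/-- `χ_t(a) = a(t)`, for `t` an element of `ℂ_∞`. -/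
def chi (t : Cinf F) : F[X] →+* Cinf F :=
  Polynomial.eval₂RingHom ((toC F).comp Polynomial.C) t

/-! ### Lattices and their exponential functions -/

/-- The exponential function `e_Λ(ζ) = ζ ∏_{w ∈ Λ ∖ 0} (1 - ζ / w)` of a lattice `Λ ⊂ ℂ_∞`. -/
def latticeExp (Λ : Set (Cinf F)) (ζ : Cinf F) : Cinf F :=
  ζ * ∏' w : ↥(Λ \ {0}), (1 - ζ / (w : Cinf F))

/-- The lattice `ϖ A`. -/
def rankOneLattice (ϖ : Cinf F) : Set (Cinf F) :=
  Set.range fun a : F[X] => ϖ * toC F a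

/-- The lattice `Λ_z = z A + A`. -/
def rankTwoLattice (z : Cinf F) : Set (Cinf F) :=
  Set.range fun cd : F[X] × F[X] => toC F cd.1 * z + toC F cd.2

/-- `ϖ A` is the lattice of the Carlitz module `θ ↦ θ τ⁰ + τ`, that is,
`e_{ϖ A}(θ ζ) = θ e_{ϖ A}(ζ) + e_{ϖ A}(ζ) ^ q`. (This fails for `ϖ = 0`.) -/
def IsCarlitzPeriod (ϖ : Cinf F) : Prop :=
  ∀ ζ : Cinf F,
    latticeExp (rankOneLattice ϖ) (toC F X * ζ) =
      toC F X * latticeExp (rankOneLattice ϖ) ζ +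
        latticeExp (rankOneLattice ϖ) ζ ^ Fintype.card F

/-! ### The functions `s_Car`, `s₁`, `s₂`, `d₁`, `d₂`, as power series in `t` -/

/-- `s_Car(t) = ∑ e_{ϖ A}(ϖ / θ^(n+1)) t^n`. -/
def sCar (ϖ : Cinf F) : PowerSeries (Cinf F) :=
  PowerSeries.mk fun n => latticeExp (rankOneLattice ϖ) (ϖ / toC F X ^ (n + 1))

/-- `s₁(z, t) = ∑ e_{Λ_z}(z / θ^(n+1)) t^n`. -/
def s₁ (z : Cinf F) : PowerSeries (Cinf F) :=
  PowerSeries.mk fun n => latticeExp (rankTwoLattice z) (z / toC F X ^ (n + 1))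

/-- `s₂(z, t) = ∑ e_{Λ_z}(1 / θ^(n+1)) t^n`. -/
def s₂ (z : Cinf F) : PowerSeries (Cinf F) :=
  PowerSeries.mk fun n => latticeExp (rankTwoLattice z) (1 / toC F X ^ (n + 1))

/-- The value at `t` of the analytic function given by a power series. -/
def evalAt (f : PowerSeries (Cinf F)) (t : Cinf F) : Cinf F :=
  ∑' n : ℕ, PowerSeries.coeff n f * t ^ n

/-- `d₁(z, t)`, where `d₁ = ϖ s_Car⁻¹ s₁`. The quotient is taken in `ℂ_∞[[t]]`, where `s_Car` has a
nonzero constant term. The resulting series is entire in `t`, so this is the quotient of the values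
of `ϖ s₁` and `s_Car` for `|t| < q` and its analytic continuation beyond. -/
def d₁ (ϖ z t : Cinf F) : Cinf F := evalAt (PowerSeries.C ϖ * (sCar ϖ)⁻¹ * s₁ z) t

/-- `d₂(z, t)`, where `d₂ = ϖ s_Car⁻¹ s₂`, in the same sense as for `d₁`. -/
def d₂ (ϖ z t : Cinf F) : Cinf F := evalAt (PowerSeries.C ϖ * (sCar ϖ)⁻¹ * s₂ z) t

/-! ### Pellarin's `L`-series and the sequences `𝒢_{l,k}` -/

/-- The term `χ_t(a)^α a^{-β}` of `L(χ_t^α, β)` at a monic `a`. -/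
def LTerm (t : Cinf F) (α β : ℕ) (a : {a : F[X] // a.Monic}) : Cinf F :=
  chi t a ^ α / toC F a ^ β

/-- `L(χ_t^α, β) = ∑_{a ∈ A₊} χ_t(a)^α a^{-β}`. -/
def LPellarin (t : Cinf F) (α β : ℕ) : Cinf F :=
  ∑' a : {a : F[X] // a.Monic}, LTerm t α β a

/-- The term at `(c, d) ≠ (0, 0)` of the series defining `𝒢_{l,k}(z, t)`. -/
def GTerm (ϖ : Cinf F) (l k : ℕ) (z t : Cinf F) (cd : {cd : F[X] × F[X] // cd ≠ 0}) : Cinf F :=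
  ((chi t cd.1.1 * d₁ ϖ z t + chi t cd.1.2 * d₂ ϖ z t) /
    (toC F cd.1.1 * z + toC F cd.1.2) ^ Fintype.card F ^ k) ^ l

/-- `𝒢_{l,k}(z, t)`. -/
def G (ϖ : Cinf F) (l k : ℕ) (z t : Cinf F) : Cinf F :=
  1 / LPellarin t l (l * Fintype.card F ^ k) *
    ∑' cd : {cd : F[X] × F[X] // cd ≠ 0}, GTerm ϖ l k z t cd

end Objects

end

end PellarinEisenstein

open Polynomial

namespace PellarinEisenstein

/-! ### Power sums of quotients of linear maps over a finite field. -/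

section PowerSums

/-! Both `χ_t(c) d₁ + χ_t(d) d₂` and `(cz + d)^(q^k)` are `F`-linear in `(c, d)`, and the latter is
injective for `z ∈ Ω`. The identity is a general fact about such pairs `ψ`, `v`. On a subspace of
finite dimension `n`, `ψ` is a `q`-polynomial in `v` of `q`-degree below `n`, so away from `0` the
quotient `ψ / v` is `R(v)` with `deg R ≤ q^(n-1) - 1`. For `l ≤ q` the degree of `R^l` is below `q^n
- 1`, hence its values on the subspace sum to zero and the sum over nonzero vectors is `-R(0)^l`.
Comparison with `l = 1` gives `S_l = (-1)^(l+1) S_1^l`, and this passes to the limit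
(`hasSum_div_pow_eq`). It is applied twice: to `A × A` for the numerators, and to `A` with `χ_t(a)`
and `a^(q^k)` for the `L`-values. There the full sum is `-L`, since `#Fˣ = -1` in `F`, so the signs
cancel and `L_l = L_1^l`. -/

/-- The values of a polynomial of degree less than `#M - 1` on a finite additive subgroup of a field
add up to zero. -/
lemma sum_eval_addMonoidHom_eq_zero {M K : Type*} [AddCommGroup M] [Fintype M] [Field K]
    (v : M →+ K) (hv : Function.Injective v) (Q : K[X])
    (hQ : Q.natDegree + 1 < Fintype.card M) : ∑ m, Q.eval (v m) = 0 := by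
  classical
  have hdeg : Q.degree < (Finset.univ : Finset M).card := by
    refine degree_le_natDegree.trans_lt ?_
    rw [Finset.card_univ]
    exact_mod_cast (by omega : Q.natDegree < Fintype.card M)
  have key := Lagrange.coeff_eq_sum (s := Finset.univ) (v := v) hv.injOn hdeg
  -- The substitution `j ↦ i - j` makes every Lagrange denominator the same, so the coefficient of
  -- degree `#M - 1`, which vanishes, is the sum of values over one constant.
  have hprod (i : M) :
      ∏ j ∈ Finset.univ.erase i, (v i - v j) = ∏ j ∈ Finset.univ.erase (0 : M), v j := by
    refine Finset.prod_bij' (fun j _ => i - j) (fun j _ => i - j) ?_ ?_ ?_ ?_ ?_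
    · intro j hj
      simpa [sub_eq_zero, eq_comm] using hj
    · intro j hj
      simpa using hj
    · simp
    · simp
    · simp
  have hne : ∏ j ∈ Finset.univ.erase (0 : M), v j ≠ 0 :=
    Finset.prod_ne_zero_iff.2 fun j hj => by
      simpa using (map_ne_zero_iff v hv).2 (Finset.ne_of_mem_erase hj)
  rw [Finset.card_univ, coeff_eq_zero_of_natDegree_lt (by omega)] at key
  simp only [hprod, ← Finset.sum_div] at key
  exact (div_eq_zero_iff.1 key.symm).resolve_right hne

variable {F M K : Type*} [Field F] [Fintype F] [AddCommGroup M] [Module F M] [Field K] [Algebra F K]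

lemma frobeniusAlgHom_pow_apply (i : ℕ) (x : K) :
    (FiniteField.frobeniusAlgHom F K ^ i) x = x ^ Fintype.card F ^ i := by
  induction i generalizing x with
  | zero => simp
  | succ i ih => rw [pow_succ, AlgHom.mul_apply, ih]; simp [← pow_mul, pow_succ']

/-- The linear map `m ↦ v(m) ^ (q ^ i)`. -/
noncomputable def powCard (v : M →ₗ[F] K) (i : ℕ) : M →ₗ[F] K :=
  (FiniteField.frobeniusAlgHom F K ^ i).toLinearMap ∘ₗ v

@[simp]
lemma powCard_apply (v : M →ₗ[F] K) (i : ℕ) (m : M) :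
    powCard v i m = v m ^ Fintype.card F ^ i :=
  frobeniusAlgHom_pow_apply i (v m)

lemma powCard_injective (v : M →ₗ[F] K) (hv : Function.Injective v) (i : ℕ) :
    Function.Injective (powCard v i) :=
  (FiniteField.frobeniusAlgHom F K ^ i).toRingHom.injective.comp hv

/-- Linear functions on a finite `F`-subspace of a field are interpolated by `q`-polynomials of
`q`-degree less than the dimension. -/
lemma exists_qPolynomial_interpolation [Finite M] (v ψ : M →ₗ[F] K) (hv : Function.Injective v) :
    ∃ p : Fin (Module.finrank F M) → K,
      ∀ m, ψ m = ∑ i, p i * v m ^ Fintype.card F ^ (i : ℕ) := by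
  classical
  have := Fintype.ofFinite M
  set n := Module.finrank F M with hn
  have hq : 1 < Fintype.card F := Fintype.one_lt_card
  have hcard : Fintype.card M = Fintype.card F ^ n := Module.card_eq_pow_finrank
  let b : Module.Basis (Fin n) F M := Module.finBasis F M
  let Φ : (Fin n → K) → (M →ₗ[F] K) := fun p => ∑ i, p i • powCard v (i : ℕ)
  have hΦ (p m) : Φ p m = ∑ i, p i * v m ^ Fintype.card F ^ (i : ℕ) := by
    simp [Φ, LinearMap.sum_apply]
  let T : (Fin n → K) →ₗ[K] (Fin n → K) :=
    { toFun := fun p j => Φ p (b j)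
      map_add' := fun p p' => by
        ext j
        simp [hΦ, add_mul, Finset.sum_add_distrib]
      map_smul' := fun c p => by
        ext j
        simp [hΦ, Finset.mul_sum, mul_assoc] }
  -- A kernel element gives a polynomial of degree below `q^n` with `q^n` roots; equal dimensions
  -- then give surjectivity.
  have hT : Function.Injective T := by
    refine (injective_iff_map_eq_zero T).2 fun p hp => ?_
    have h0 : Φ p = 0 := b.ext fun j => congrFun hp j
    let P : K[X] := ∑ i : Fin n, C (p i) * X ^ Fintype.card F ^ (i : ℕ)
    have hP : P = 0 := by
      refine eq_zero_of_natDegree_lt_card_of_eval_eq_zero P hv (fun m => ?_) ?_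
      · have := hΦ p m
        rw [h0] at this
        simpa [P, eval_finsetSum] using this.symm
      · rw [hcard]
        refine (natDegree_sum_le_of_forall_le (n := Fintype.card F ^ n - 1) _ _
          fun i _ => ?_).trans_lt (Nat.sub_lt (by positivity) one_pos)
        exact (natDegree_C_mul_X_pow_le _ _).trans
          (Nat.le_sub_one_of_lt (Nat.pow_lt_pow_right hq i.2))
    ext i
    have := congrArg (fun R : K[X] => R.coeff (Fintype.card F ^ (i : ℕ))) hP
    simpa [P, finsetSum_coeff, coeff_C_mul, coeff_X_pow, (Nat.pow_right_injective hq).eq_iff,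
      Fin.val_inj] using this
  obtain ⟨p, hp⟩ := LinearMap.injective_iff_surjective.1 hT fun j => ψ (b j)
  have : Φ p = ψ := b.ext fun j => congrFun hp j
  exact ⟨p, fun m => by rw [← this, hΦ]⟩

/-- For linear `ψ` and `v` on a finite `F`-space with `v` injective, the power sums of `ψ / v` of
exponents `1 ≤ l ≤ q` are up to sign those of a single element. -/
lemma exists_sum_div_pow_eq_neg_pow [Fintype M] (v ψ : M →ₗ[F] K) (hv : Function.Injective v) :
    ∃ p₀ : K, ∀ l : ℕ, 1 ≤ l → l ≤ Fintype.card F → ∑ m, (ψ m / v m) ^ l = -p₀ ^ l := by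
  classical
  obtain ⟨p, hp⟩ := exists_qPolynomial_interpolation v ψ hv
  have hcard : Fintype.card M = Fintype.card F ^ Module.finrank F M := Module.card_eq_pow_finrank
  have hq : 1 < Fintype.card F := Fintype.one_lt_card
  generalize Module.finrank F M = n at p hp hcard
  let R : K[X] := ∑ i : Fin n, C (p i) * X ^ (Fintype.card F ^ (i : ℕ) - 1)
  refine ⟨R.eval 0, fun l hl hlq => ?_⟩
  -- At `m = 0` this fails: the quotient is `0 / 0 = 0`, while `R` takes the value `R(0)`. That
  -- discrepancy is the whole sum.
  have hR (m : M) (hm : m ≠ 0) : ψ m / v m = R.eval (v m) := by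
    have hvm : v m ≠ 0 := (map_ne_zero_iff v hv).2 hm
    rw [hp, Finset.sum_div]
    simp only [R, eval_finsetSum, eval_mul, eval_C, eval_pow, eval_X]
    refine Finset.sum_congr rfl fun i _ => ?_
    rw [mul_div_assoc, div_eq_iff_mul_eq hvm |>.2 (pow_sub_one_mul (by positivity) _)]
  have hsum : ∑ m, (R ^ l).eval (v m) = 0 := by
    -- In dimension `0` the degree criterion does not apply, but `R = 0`. In dimension `n + 1`, `l ≤
    -- q` gives `deg R^l ≤ q^(n+1) - q`, which is below `q^(n+1) - 1` because `q ≥ 2`.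
    rcases n with _ | n
    · simp [R, Nat.one_le_iff_ne_zero.1 hl]
    refine sum_eval_addMonoidHom_eq_zero v.toAddMonoidHom hv _ ?_
    have h1 : R.natDegree ≤ Fintype.card F ^ n - 1 := by
      refine natDegree_sum_le_of_forall_le _ _ fun i _ => (natDegree_C_mul_X_pow_le _ _).trans ?_
      exact Nat.sub_le_sub_right (Nat.pow_le_pow_right (by omega) (by omega)) 1
    have h2 : (R ^ l).natDegree ≤ l * (Fintype.card F ^ n - 1) :=
      natDegree_pow_le.trans (Nat.mul_le_mul_left l h1)
    have h3 : l * (Fintype.card F ^ n - 1) ≤ Fintype.card F * (Fintype.card F ^ n - 1) :=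
      Nat.mul_le_mul_right _ hlq
    have h4 : 1 ≤ Fintype.card F ^ n := Nat.one_le_pow _ _ (by omega)
    have h5 : Fintype.card F ≤ Fintype.card F * Fintype.card F ^ n := Nat.le_mul_of_pos_right _ h4
    rw [hcard, pow_succ']
    rw [Nat.mul_sub (Fintype.card F), Nat.mul_one] at h3
    omega
  rw [← Finset.add_sum_erase _ _ (Finset.mem_univ (0 : M))] at hsum ⊢
  rw [Finset.sum_congr rfl fun m hm => by
    rw [hR m (Finset.ne_of_mem_erase hm), ← eval_pow]]
  simp only [map_zero, div_zero, zero_pow (by omega : l ≠ 0), zero_add]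
  rw [eq_neg_of_add_eq_zero_right hsum]
  simp

/-- The power sums of `ψ / v`, for `ψ` and `v` linear on an `F`-space with `v` injective. -/
lemma hasSum_div_pow_eq [TopologicalSpace K] [IsTopologicalRing K] [T2Space K] (v ψ : M →ₗ[F] K)
    (hv : Function.Injective v) {l : ℕ} (hl : 1 ≤ l) (hlq : l ≤ Fintype.card F) {S S' : K}
    (hS : HasSum (fun m => ψ m / v m) S) (hS' : HasSum (fun m => (ψ m / v m) ^ l) S') :
    S' = (-1) ^ (l + 1) * S ^ l := by
  classical
  -- The identity holds for sums over finite subspaces only, but these are cofinal among finite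
  -- subsets, since spans of finite sets are finite.
  refine tendsto_nhds_unique_of_frequently_eq hS' ((hS.pow l).const_mul ((-1 : K) ^ (l + 1))) ?_
  refine Filter.frequently_atTop.2 fun s => ?_
  let W := Submodule.span F (s : Set M)
  have : Finite W := Module.finite_of_finite F
  have := Fintype.ofFinite W
  refine ⟨(W : Set M).toFinset, fun m hm => by simpa using Submodule.subset_span hm, ?_⟩
  obtain ⟨p₀, h⟩ := exists_sum_div_pow_eq_neg_pow (v ∘ₗ W.subtype) (ψ ∘ₗ W.subtype)
    (hv.comp W.subtype_injective)
  have h1 := h 1 le_rfl Fintype.card_pos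
  have hl' := h l hl hlq
  simp only [pow_one] at h1
  have hW (f : M → K) : ∑ m ∈ (W : Set M).toFinset, f m = ∑ m : W, f m :=
    (Finset.sum_set_coe (W : Set M)).symm
  simp only [LinearMap.comp_apply, Submodule.subtype_apply] at h1 hl'
  rw [hW, hW, hl', h1]
  rw [neg_pow p₀ l, ← mul_assoc, ← pow_add, show l + 1 + l = 2 * l + 1 by ring]
  simp [pow_succ, pow_mul]

end PowerSums

/-! ### Ultrametric norms and lattice points. -/

variable {F : Type*} [Field F] [Fintype F]

instance : IsUltrametricDist (KinfAlgCl F) :=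
  IsUltrametricDist.isUltrametricDist_of_isNonarchimedean_norm
    (isNonarchimedean_spectralNorm (K := Kinf F) (L := KinfAlgCl F))

instance : IsUltrametricDist (Cinf F) :=
  IsUltrametricDist.isUltrametricDist_of_forall_norm_add_le_max_norm fun x y => by
    refine UniformSpace.Completion.induction_on₂ x y
      (isClosed_le (by fun_prop) (by fun_prop)) fun a b => ?_
    rw [← UniformSpace.Completion.coe_add]
    simp only [UniformSpace.Completion.norm_coe]
    exact IsUltrametricDist.norm_add_le_max a b

lemma norm_toC {a : F[X]} (ha : a ≠ 0) : ‖toC F a‖ = (Fintype.card F : ℝ) ^ a.natDegree := by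
  have h : algebraMap F[X] (RatFunc F) a ≠ 0 := by simpa using ha
  simp only [toC, RingHom.comp_apply]
  rw [norm_algebraMap', norm_toKinf]
  simp [inftyAbs, h, RatFunc.intDegree_polynomial]

lemma norm_toC_le (a : F[X]) : ‖toC F a‖ ≤ (Fintype.card F : ℝ) ^ a.natDegree := by
  rcases eq_or_ne a 0 with rfl | ha
  · simp
  · exact (norm_toC ha).le

lemma toC_injective : Function.Injective (toC F) :=
  (injective_iff_map_eq_zero _).2 fun a ha => by
    by_contra h
    have h1 := norm_toC h
    have h2 := one_lt_q F
    rw [ha, norm_zero] at h1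
    exact (pow_pos (by positivity) _).ne h1

lemma norm_chi_le (t : Cinf F) (a : F[X]) : ‖chi t a‖ ≤ max 1 ‖t‖ ^ a.natDegree := by
  have h1 : (1 : ℝ) ≤ max 1 ‖t‖ := le_max_left _ _
  simp only [chi, coe_eval₂RingHom, eval₂_eq_sum_range]
  refine IsUltrametricDist.norm_sum_le_of_forall_le_of_nonneg (by positivity) fun i hi => ?_
  rw [norm_mul, norm_pow]
  have h2 : ‖((toC F).comp C) (a.coeff i)‖ ≤ 1 := by
    simpa using norm_toC_le (C (a.coeff i))
  calc _ ≤ 1 * max 1 ‖t‖ ^ i :=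
        mul_le_mul h2 (pow_le_pow_left₀ (norm_nonneg _) (le_max_right _ _) i) (by positivity)
          zero_le_one
    _ ≤ _ := by
      rw [one_mul]
      exact pow_le_pow_right₀ h1 (by simpa [Nat.lt_succ_iff] using hi)

/-- For `z ∈ Ω` the norm of `c z + d` is bounded below by a multiple of `max |c| |d|`. -/
lemma exists_le_norm_lattice {z : Cinf F} (hz : z ∈ Omega F) :
    ∃ B : ℝ, 0 < B ∧ ∀ c d : F[X], (c, d) ≠ 0 →
      (Fintype.card F : ℝ) ^ max c.natDegree d.natDegree ≤ B * ‖toC F c * z + toC F d‖ := by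
  have hiso : Isometry (algebraMap (Kinf F) (Cinf F)) := algebraMap_isometry _ _
  have hclosed : IsClosed (Set.range (algebraMap (Kinf F) (Cinf F))) :=
    hiso.isClosedEmbedding.isClosed_range
  obtain ⟨δ, hδ, hball⟩ := Metric.isOpen_iff.1 hclosed.isOpen_compl z hz
  have hq := one_lt_q F
  -- `K_∞` is complete, hence closed, so `z` has distance at least `δ` from `-d/c`.
  have hc (c d : F[X]) : δ * ‖toC F c‖ ≤ ‖toC F c * z + toC F d‖ := by
    rcases eq_or_ne c 0 with rfl | hc0
    · simp
    have hc1 : toC F c ≠ 0 := (map_ne_zero_iff _ toC_injective).2 hc0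
    have hmem : -(toC F d / toC F c) ∈ Set.range (algebraMap (Kinf F) (Cinf F)) :=
      ⟨-(toKinf F (algebraMap _ _ d) / toKinf F (algebraMap _ _ c)), by simp [toC]⟩
    have hdist : δ ≤ ‖z + toC F d / toC F c‖ := by
      by_contra! h
      refine hball (a := -(toC F d / toC F c)) ?_ hmem
      rwa [Metric.mem_ball, dist_comm, dist_eq_norm, sub_neg_eq_add]
    calc δ * ‖toC F c‖ ≤ ‖z + toC F d / toC F c‖ * ‖toC F c‖ := by gcongr
      _ = _ := by rw [← norm_mul]; congr 1; field_simp
  have hd (c d : F[X]) :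
      ‖toC F d‖ ≤ max 1 (‖z‖ / δ) * ‖toC F c * z + toC F d‖ := by
    have h1 : ‖toC F d‖ ≤ max ‖toC F c * z + toC F d‖ ‖toC F c * z‖ := by
      simpa using
        IsUltrametricDist.norm_add_le_max (toC F c * z + toC F d) (-(toC F c * z))
    refine h1.trans (max_le ?_ ?_)
    · exact le_mul_of_one_le_left (norm_nonneg _) (le_max_left _ _)
    · calc ‖toC F c * z‖ = ‖z‖ / δ * (δ * ‖toC F c‖) := by rw [norm_mul]; field_simp
        _ ≤ _ := mul_le_mul (le_max_right _ _) (hc c d) (by positivity) (by positivity)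
  refine ⟨max (1 / δ) (max 1 (‖z‖ / δ)), by positivity, fun c d hcd => ?_⟩
  have hc' : ‖toC F c‖ ≤ 1 / δ * ‖toC F c * z + toC F d‖ := by
    rw [one_div_mul_eq_div, le_div_iff₀ hδ, mul_comm]
    exact hc c d
  have hcb := hc'.trans (mul_le_mul_of_nonneg_right
    (le_max_left (1 / δ) (max 1 (‖z‖ / δ))) (norm_nonneg _))
  have hdb := (hd c d).trans (mul_le_mul_of_nonneg_right
    (le_max_right (1 / δ) (max 1 (‖z‖ / δ))) (norm_nonneg _))
  rcases eq_or_ne c 0 with rfl | hc0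
  · have : d ≠ 0 := fun h => hcd (by simp [h])
    rw [norm_toC this] at hdb
    simpa using hdb
  rcases eq_or_ne d 0 with rfl | hd0
  · rw [norm_toC hc0] at hcb
    simpa using hcb
  rw [norm_toC hc0] at hcb
  rw [norm_toC hd0] at hdb
  rcases max_cases c.natDegree d.natDegree with ⟨h, -⟩ | ⟨h, -⟩ <;> rw [h] <;> assumption

/-! ### Finiteness in bounded degree and summability. -/

lemma finite_setOf_natDegree_lt (n : ℕ) : {a : F[X] | a.natDegree < n}.Finite := by
  have : Finite (degreeLT F n) := Finite.of_equiv _ (degreeLTEquiv F n).symm.toEquiv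
  refine (Set.toFinite (degreeLT F n : Set F[X])).subset fun a ha => ?_
  rw [SetLike.mem_coe, mem_degreeLT]
  exact degree_le_natDegree.trans_lt (by exact_mod_cast ha)

lemma tendsto_natDegree_cofinite :
    Filter.Tendsto (natDegree : F[X] → ℕ) Filter.cofinite Filter.atTop := by
  refine Filter.tendsto_atTop.2 fun n => ?_
  simpa [Filter.eventually_cofinite] using finite_setOf_natDegree_lt n

lemma tendsto_max_natDegree_cofinite :
    Filter.Tendsto (fun cd : F[X] × F[X] => max cd.1.natDegree cd.2.natDegree)
      Filter.cofinite Filter.atTop := by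
  refine Filter.tendsto_atTop.2 fun n => ?_
  refine (((finite_setOf_natDegree_lt n).prod (finite_setOf_natDegree_lt n)).subset ?_)
  rintro ⟨c, d⟩ h
  simpa using h

/-- A family bounded by a geometric sequence in an exponent that tends to infinity has summable
powers. -/
lemma summable_pow_of_norm_le_geometric {ι : Type*} {f : ι → Cinf F} {N : ι → ℕ}
    (hN : Filter.Tendsto N Filter.cofinite Filter.atTop) {D r : ℝ} (hr0 : 0 ≤ r) (hr1 : r < 1)
    (hf : ∀ i, ‖f i‖ ≤ D * r ^ N i) {l : ℕ} (hl : 1 ≤ l) : Summable fun i => f i ^ l := by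
  have h0 : Filter.Tendsto f Filter.cofinite (nhds 0) := by
    refine squeeze_zero_norm hf ?_
    simpa using ((tendsto_pow_atTop_nhds_zero_of_lt_one hr0 hr1).comp hN).const_mul D
  refine NonarchimedeanAddGroup.summable_of_tendsto_cofinite_zero ?_
  simpa [zero_pow (by omega : l ≠ 0)] using h0.pow l

/-! ### The linear maps behind the two series. -/

/-- `ℂ_∞` as an algebra over the field of constants. -/
noncomputable abbrev constAlgebra : Algebra F (Cinf F) := ((toC F).comp C).toAlgebra

attribute [local instance] constAlgebra

/-- The embedding `A → ℂ_∞` as a linear map. -/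
noncomputable def toCLinear : F[X] →ₗ[F] Cinf F where
  toFun := toC F
  map_add' := map_add _
  map_smul' c a := by
    rw [smul_eq_C_mul, map_mul, RingHom.id_apply, Algebra.smul_def]
    rfl

/-- The character `χ_t` as a linear map. -/
noncomputable def chiLinear (t : Cinf F) : F[X] →ₗ[F] Cinf F where
  toFun := chi t
  map_add' := map_add _
  map_smul' c a := by
    have h : chi t (C c) = algebraMap F (Cinf F) c := eval₂_C _ _
    rw [smul_eq_C_mul, map_mul, RingHom.id_apply, Algebra.smul_def, h]

/-- The linear map `(c, d) ↦ f(c) x + f(d) y`. -/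
noncomputable def pairing (f : F[X] →ₗ[F] Cinf F) (x y : Cinf F) : F[X] × F[X] →ₗ[F] Cinf F :=
  (LinearMap.mulRight F x ∘ₗ f).coprod (LinearMap.mulRight F y ∘ₗ f)

lemma pairing_apply (f : F[X] →ₗ[F] Cinf F) (x y : Cinf F) (cd : F[X] × F[X]) :
    pairing f x y cd = f cd.1 * x + f cd.2 * y := rfl

lemma pairing_toC_one_apply (z : Cinf F) (cd : F[X] × F[X]) :
    pairing toCLinear z 1 cd = toC F cd.1 * z + toC F cd.2 := by
  rw [pairing_apply, mul_one]
  rfl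

lemma pairing_toC_one_injective {z : Cinf F} (hz : z ∈ Omega F) :
    Function.Injective (pairing toCLinear z 1) := by
  obtain ⟨B, hB, h⟩ := exists_le_norm_lattice hz
  refine (injective_iff_map_eq_zero _).2 fun cd hcd => ?_
  by_contra h0
  have h1 := h cd.1 cd.2 h0
  have hq := one_lt_q F
  rw [← pairing_toC_one_apply, hcd, norm_zero, mul_zero] at h1
  exact absurd h1 (not_le.2 (by positivity))

/-! ### Geometric bounds on the terms. -/

lemma max_one_norm_lt {t : Cinf F} {k : ℕ}
    (ht : ‖t‖ < (Fintype.card F : ℝ) ^ Fintype.card F ^ k) :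
    max 1 ‖t‖ / (Fintype.card F : ℝ) ^ Fintype.card F ^ k < 1 := by
  have hq := one_lt_q F
  rw [div_lt_one (by positivity)]
  exact max_lt (one_lt_pow₀ hq (pow_ne_zero _ Fintype.card_ne_zero)) ht

lemma norm_chi_div_toC_pow_le (t : Cinf F) (k : ℕ) (a : F[X]) :
    ‖chiLinear t a / powCard toCLinear k a‖ ≤
      (max 1 ‖t‖ / (Fintype.card F : ℝ) ^ Fintype.card F ^ k) ^ a.natDegree := by
  have hq := one_lt_q F
  rcases eq_or_ne a 0 with rfl | ha
  · simp
  have h : ‖toCLinear a‖ = (Fintype.card F : ℝ) ^ a.natDegree := norm_toC ha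
  rw [norm_div, powCard_apply, norm_pow, h, div_pow, ← pow_mul, ← pow_mul, mul_comm a.natDegree]
  exact div_le_div_of_nonneg_right (norm_chi_le t a) (by positivity)

/-- With `N = max (deg c) (deg d)`, the numerator is `O(max(1, |t|)^N)`, while the denominator is at
least `(q^N / B)^(q^k)`. -/
lemma exists_norm_pairing_div_le {z : Cinf F} (hz : z ∈ Omega F) (t x y : Cinf F) (k : ℕ) :
    ∃ D : ℝ, ∀ cd : F[X] × F[X],
      ‖pairing (chiLinear t) x y cd / powCard (pairing toCLinear z 1) k cd‖ ≤
        D * (max 1 ‖t‖ / (Fintype.card F : ℝ) ^ Fintype.card F ^ k) ^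
          max cd.1.natDegree cd.2.natDegree := by
  have hq := one_lt_q F
  obtain ⟨B, hB, h⟩ := exists_le_norm_lattice hz
  refine ⟨max ‖x‖ ‖y‖ * B ^ Fintype.card F ^ k, fun cd => ?_⟩
  rcases eq_or_ne cd 0 with rfl | hcd
  · simp only [map_zero, div_zero, norm_zero]
    positivity
  set N := max cd.1.natDegree cd.2.natDegree
  have hv0 : 0 < ‖pairing toCLinear z 1 cd‖ :=
    norm_pos_iff.2 ((map_ne_zero_iff _ (pairing_toC_one_injective hz)).2 hcd)
  have hv : (Fintype.card F : ℝ) ^ N ≤ B * ‖pairing toCLinear z 1 cd‖ := by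
    rw [pairing_toC_one_apply]
    exact h cd.1 cd.2 hcd
  have h1 : (1 : ℝ) ≤ max 1 ‖t‖ := le_max_left _ _
  have hchi (a : F[X]) (ha : a.natDegree ≤ N) (w : Cinf F) (hw : ‖w‖ ≤ max ‖x‖ ‖y‖) :
      ‖chiLinear t a * w‖ ≤ max ‖x‖ ‖y‖ * max 1 ‖t‖ ^ N := by
    rw [norm_mul, mul_comm]
    exact mul_le_mul hw ((norm_chi_le t a).trans (pow_le_pow_right₀ h1 ha)) (norm_nonneg _)
      (by positivity)
  have hψ : ‖pairing (chiLinear t) x y cd‖ ≤ max ‖x‖ ‖y‖ * max 1 ‖t‖ ^ N :=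
    (IsUltrametricDist.norm_add_le_max _ _).trans
      (max_le (hchi _ (le_max_left _ _) _ (le_max_left _ _))
        (hchi _ (le_max_right _ _) _ (le_max_right _ _)))
  rw [norm_div, powCard_apply, norm_pow, div_pow, ← pow_mul, mul_comm (Fintype.card F ^ k) N,
    pow_mul, div_le_iff₀ (by positivity)]
  refine hψ.trans ?_
  have hpow := pow_le_pow_left₀ (by positivity) hv (Fintype.card F ^ k)
  rw [mul_pow] at hpow
  calc max ‖x‖ ‖y‖ * max 1 ‖t‖ ^ N
      = max ‖x‖ ‖y‖ * (max 1 ‖t‖ ^ N / ((Fintype.card F : ℝ) ^ N) ^ Fintype.card F ^ k) *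
          ((Fintype.card F : ℝ) ^ N) ^ Fintype.card F ^ k := by field_simp
    _ ≤ max ‖x‖ ‖y‖ * (max 1 ‖t‖ ^ N / ((Fintype.card F : ℝ) ^ N) ^ Fintype.card F ^ k) *
          (B ^ Fintype.card F ^ k * ‖pairing toCLinear z 1 cd‖ ^ Fintype.card F ^ k) := by gcongr
    _ = _ := by ring

/-! ### The `L`-values. -/

/-- Every nonzero polynomial is uniquely a unit times a monic one. -/
noncomputable def unitsProdMonicEquiv : Fˣ × {a : F[X] // a.Monic} ≃ {a : F[X] // a ≠ 0} where
  toFun x := ⟨C (x.1 : F) * x.2, mul_ne_zero (by simp) x.2.2.ne_zero⟩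
  invFun a := (Units.mk0 a.1.leadingCoeff (leadingCoeff_ne_zero.2 a.2),
    ⟨C a.1.leadingCoeff⁻¹ * a.1, by
      rw [mul_comm]; exact monic_mul_leadingCoeff_inv a.2⟩)
  left_inv := by
    rintro ⟨u, a, ha⟩
    ext1
    · ext
      simp [leadingCoeff_mul, ha.leadingCoeff]
    · ext1
      simp [leadingCoeff_mul, ha.leadingCoeff, ← mul_assoc, ← C_mul]
  right_inv := by
    rintro ⟨a, ha⟩
    ext1
    simp [← mul_assoc, ← C_mul, ha]

lemma tsum_eq_neg_tsum_monic {f : F[X] → Cinf F} (hf : Summable f) (h0 : f 0 = 0)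
    (hunit : ∀ (u : Fˣ) (a : F[X]), f (C (u : F) * a) = f a) :
    ∑' a, f a = -∑' a : {a : F[X] // a.Monic}, f a := by
  classical
  have hsupp : Function.support f ⊆ {a : F[X] | a ≠ 0} := fun a ha ha0 => ha (by rw [ha0, h0])
  have h1 : ∑' a : {a : F[X] // a ≠ 0}, f a = ∑' a, f a := tsum_subtype_eq_of_support_subset hsupp
  have h2 : Summable fun a : {a : F[X] // a ≠ 0} => f a := hf.subtype _
  rw [← h1, ← unitsProdMonicEquiv.tsum_eq]
  have h3 := (unitsProdMonicEquiv.summable_iff (f := fun a : {a : F[X] // a ≠ 0} => f a)).2 h2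
  have hcard : ((Fintype.card Fˣ : ℕ) : Cinf F) = -1 := by
    have hF : ((Fintype.card F : ℕ) : Cinf F) = 0 := by
      rw [← map_natCast (algebraMap F (Cinf F)), FiniteField.cast_card_eq_zero, map_zero]
    rw [Fintype.card_units, Nat.cast_sub Fintype.card_pos, hF]
    simp
  refine (Summable.tsum_prod h3).trans ?_
  simp only [Function.comp_apply, unitsProdMonicEquiv, Equiv.coe_fn_mk, hunit]
  rw [tsum_fintype, Finset.sum_const, Finset.card_univ, nsmul_eq_mul, hcard, neg_one_mul]

variable {t : Cinf F} {k l : ℕ}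

lemma LTerm_eq (t : Cinf F) (k l : ℕ) (a : {a : F[X] // a.Monic}) :
    LTerm t l (l * Fintype.card F ^ k) a =
      (chiLinear t a.1 / powCard toCLinear k a.1) ^ l := by
  rw [powCard_apply, div_pow, ← pow_mul, mul_comm (Fintype.card F ^ k)]
  rfl

lemma summable_chi_div_toC_pow (ht : ‖t‖ < (Fintype.card F : ℝ) ^ Fintype.card F ^ k)
    (hl : 1 ≤ l) : Summable fun a : F[X] => (chiLinear t a / powCard toCLinear k a) ^ l :=
  summable_pow_of_norm_le_geometric tendsto_natDegree_cofinite (D := 1) (by positivity)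
    (max_one_norm_lt ht) (fun a => by simpa using norm_chi_div_toC_pow_le t k a) hl

lemma summable_LTerm (ht : ‖t‖ < (Fintype.card F : ℝ) ^ Fintype.card F ^ k) (hl : 1 ≤ l) :
    Summable (LTerm t l (l * Fintype.card F ^ k)) :=
  ((summable_chi_div_toC_pow ht hl).subtype {a | a.Monic}).congr fun a => (LTerm_eq t k l a).symm

lemma tsum_chi_div_toC_pow (ht : ‖t‖ < (Fintype.card F : ℝ) ^ Fintype.card F ^ k) (hl : 1 ≤ l) :
    ∑' a : F[X], (chiLinear t a / powCard toCLinear k a) ^ l =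
      -LPellarin t l (l * Fintype.card F ^ k) := by
  rw [tsum_eq_neg_tsum_monic (summable_chi_div_toC_pow ht hl) (by simp; omega), LPellarin]
  · simp only [LTerm_eq]
  · intro u a
    have hu : algebraMap F (Cinf F) u ≠ 0 := by simp
    rw [← smul_eq_C_mul, LinearMap.map_smul, LinearMap.map_smul, Algebra.smul_def,
      Algebra.smul_def,
      mul_div_mul_left _ _ hu]

/-- The term at `a = 1` equals `1`, and all others have norm at most a common `r < 1`, so they
cannot cancel it. -/
lemma LPellarin_ne_zero (ht : ‖t‖ < (Fintype.card F : ℝ) ^ Fintype.card F ^ k) (hl : 1 ≤ l) :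
    LPellarin t l (l * Fintype.card F ^ k) ≠ 0 := by
  classical
  set r := max 1 ‖t‖ / (Fintype.card F : ℝ) ^ Fintype.card F ^ k
  have hr0 : 0 ≤ r := by positivity
  have hr1 : r < 1 := max_one_norm_lt ht
  rw [LPellarin, (summable_LTerm ht hl).tsum_eq_add_tsum_ite ⟨1, monic_one⟩]
  have h1 : LTerm t l (l * Fintype.card F ^ k) ⟨1, monic_one⟩ = 1 := by simp [LTerm]
  rw [h1]
  intro h
  have h2 := congrArg norm (eq_neg_of_add_eq_zero_left h)
  rw [norm_neg, norm_one] at h2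
  have h3 := (IsUltrametricDist.norm_tsum_le fun a : {a : F[X] // a.Monic} =>
    if a = ⟨1, monic_one⟩ then 0 else LTerm t l (l * Fintype.card F ^ k) a).trans
    (Real.iSup_le (a := r) (fun a => ?_) hr0)
  · rw [← h2] at h3
    exact absurd h3 (not_le.2 hr1)
  · split_ifs with ha
    · simpa using hr0
    · rw [LTerm_eq, norm_pow]
      have hdeg : a.1.natDegree ≠ 0 := fun h0 =>
        ha (Subtype.ext ((a.2.natDegree_eq_zero).1 h0))
      refine (pow_le_of_le_one (norm_nonneg _) ?_ (by omega)).trans ?_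
      · exact (norm_chi_div_toC_pow_le t k a.1).trans (pow_le_one₀ hr0 hr1.le)
      · exact (norm_chi_div_toC_pow_le t k a.1).trans (pow_le_of_le_one hr0 hr1.le hdeg)

/-- Powers of `L(χ_t, q^k)` are again `L`-values. -/
lemma LPellarin_eq_pow (ht : ‖t‖ < (Fintype.card F : ℝ) ^ Fintype.card F ^ k) (hl : 1 ≤ l)
    (hlq : l ≤ Fintype.card F) :
    LPellarin t l (l * Fintype.card F ^ k) = LPellarin t 1 (1 * Fintype.card F ^ k) ^ l := by
  have h1 := (summable_chi_div_toC_pow ht le_rfl).hasSum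
  have hl' := (summable_chi_div_toC_pow ht hl).hasSum
  rw [tsum_chi_div_toC_pow ht le_rfl] at h1
  rw [tsum_chi_div_toC_pow ht hl] at hl'
  simp only [pow_one] at h1
  have h := hasSum_div_pow_eq _ _ (powCard_injective toCLinear toC_injective k) hl hlq h1 hl'
  rw [neg_pow (LPellarin _ _ _) l, ← mul_assoc, ← pow_add,
    show l + 1 + l = 2 * l + 1 by ring] at h
  simpa [pow_succ, pow_mul] using h

/-! ### The series over `(c, d)`. -/

variable {z : Cinf F}

lemma GTerm_eq (ϖ : Cinf F) (l k : ℕ) (z t : Cinf F) (cd : {cd : F[X] × F[X] // cd ≠ 0}) :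
    GTerm ϖ l k z t cd = (pairing (chiLinear t) (d₁ ϖ z t) (d₂ ϖ z t) cd.1 /
      powCard (pairing toCLinear z 1) k cd.1) ^ l := by
  rw [powCard_apply, pairing_toC_one_apply]
  rfl

lemma summable_pairing_div_pow (hz : z ∈ Omega F)
    (ht : ‖t‖ < (Fintype.card F : ℝ) ^ Fintype.card F ^ k) (hl : 1 ≤ l) (x y : Cinf F) :
    Summable fun cd : F[X] × F[X] =>
      (pairing (chiLinear t) x y cd / powCard (pairing toCLinear z 1) k cd) ^ l := by
  obtain ⟨D, hD⟩ := exists_norm_pairing_div_le hz t x y k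
  exact summable_pow_of_norm_le_geometric tendsto_max_natDegree_cofinite (by positivity)
    (max_one_norm_lt ht) hD hl

lemma summable_GTerm (hz : z ∈ Omega F)
    (ht : ‖t‖ < (Fintype.card F : ℝ) ^ Fintype.card F ^ k) (hl : 1 ≤ l) (ϖ : Cinf F) :
    Summable (GTerm ϖ l k z t) :=
  ((summable_pairing_div_pow hz ht hl _ _).subtype {cd | cd ≠ 0}).congr
    fun cd => (GTerm_eq ϖ l k z t cd).symm

/-- Including `(0, 0)` costs nothing, as `0 / 0 = 0` and `l ≥ 1`; the index set becomes a vector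
space. -/
lemma tsum_GTerm (hl : 1 ≤ l) (ϖ : Cinf F) :
    ∑' cd, GTerm ϖ l k z t cd =
      ∑' cd : F[X] × F[X], (pairing (chiLinear t) (d₁ ϖ z t) (d₂ ϖ z t) cd /
        powCard (pairing toCLinear z 1) k cd) ^ l := by
  simp only [GTerm_eq]
  refine tsum_subtype_eq_of_support_subset (s := {cd | cd ≠ 0}) (f := fun cd : F[X] × F[X] =>
    (pairing (chiLinear t) (d₁ ϖ z t) (d₂ ϖ z t) cd /
      powCard (pairing toCLinear z 1) k cd) ^ l) ?_
  rintro cd h rfl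
  exact h (by simp; omega)

lemma tsum_GTerm_eq_pow (hz : z ∈ Omega F)
    (ht : ‖t‖ < (Fintype.card F : ℝ) ^ Fintype.card F ^ k) (hl : 1 ≤ l)
    (hlq : l ≤ Fintype.card F) (ϖ : Cinf F) :
    ∑' cd, GTerm ϖ l k z t cd = (-1) ^ (l + 1) * (∑' cd, GTerm ϖ 1 k z t cd) ^ l := by
  rw [tsum_GTerm hl, tsum_GTerm le_rfl]
  have h1 := (summable_pairing_div_pow hz ht le_rfl (d₁ ϖ z t) (d₂ ϖ z t)).hasSum
  have hl' := (summable_pairing_div_pow hz ht hl (d₁ ϖ z t) (d₂ ϖ z t)).hasSum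
  simp only [pow_one] at h1 ⊢
  exact hasSum_div_pow_eq _ _ (powCard_injective _ (pairing_toC_one_injective hz) k) hl hlq h1 hl'

end PellarinEisenstein

open PellarinEisenstein in
theorem theorem1p1 {F : Type*} [Field F] [Fintype F]
    (ϖ : Cinf F) (hϖ : IsCarlitzPeriod ϖ)
    (l : ℕ) (hl : 1 ≤ l) (hlq : l ≤ Fintype.card F) (k : ℕ)
    (z : Cinf F) (hz : z ∈ Omega F)
    (t : Cinf F) (ht : ‖t‖ < (Fintype.card F : ℝ) ^ Fintype.card F ^ k) :
    Summable (LTerm t l (l * Fintype.card F ^ k)) ∧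
      LPellarin t l (l * Fintype.card F ^ k) ≠ 0 ∧
      Summable (GTerm ϖ l k z t) ∧
      G ϖ l k z t = (-1) ^ (l + 1) * G ϖ 1 k z t ^ l := by
  refine ⟨summable_LTerm ht hl, LPellarin_ne_zero ht hl, summable_GTerm hz ht hl ϖ, ?_⟩
  rw [G, G, tsum_GTerm_eq_pow hz ht hl hlq, LPellarin_eq_pow ht hl hlq, mul_pow, div_pow, one_pow]
  ring
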